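/- Let $T$ be the set of nonzero polynomials in one variable $t$ with nonnegative integer coefficients and zero constant term. Call a polynomial in one or more variables good if it has nonnegative integer coefficients and zero constant term (the zero polynomial is good), and let the size of a good polynomial be the maximum of its total degree and its coefficients (the zero polynomial has size $0$). Then there is a primitive recursive function $F:\mathbb{N}^2\to\mathbb{N}$ such that the following holds. For every coloring of $T$ with $r$ colors and all positive integers $k$ and $c_k$, there exist positive integers $c_0>c_1>\dots>c_{k-1}>c_k$ with $c_i=F(r,c_{i+1})$ for $0\le i<k$, and elements $b_1,\dots,b_k$ of $T$, such that, with $a_i=b_1b_2\cdots b_i$ for $1\le i\le k$, there is an element $x_k\in T$ with the following property: for every $0\le i<k$ and every good polynomial $P$ in $k-i$ variables of size at most $c_i$, the element $$\Big(\prod_{j=1}^{i}a_j\Big)x_k+P(a_{i+1},b_{i+2},\dots,b_k)$$ has the same color as $\big(\prod_{j=1}^{i}a_j\big)x_k$ (the empty product, for $i=0$, leaves just $x_k$). -/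

import Mathlib

open scoped Polynomial

namespace GoodPoly

/-- The semi-ring `T` (without zero and one) of nonzero polynomials in one variable `t` with
nonnegative integer coefficients and zero constant term. -/
abbrev T : Type := {p : ℕ[X] // p ≠ 0 ∧ p.coeff 0 = 0}

/-- A polynomial in several variables with nonnegative integer coefficients is good if its
constant term is zero. The zero polynomial is good. -/
def IsGood {σ : Type*} (P : MvPolynomial σ ℕ) : Prop :=
  MvPolynomial.constantCoeff P = 0

/-- The size of a polynomial: the maximum of its total degree and of its coefficients, that is,
the least `c` that bounds all of them. The zero polynomial has size `0`. -/
def size {σ : Type*} (P : MvPolynomial σ ℕ) : ℕ :=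
  max P.totalDegree (P.support.sup fun m => P.coeff m)

/-- `a b i = b 1 * ⋯ * b i`, as a polynomial in `t`. -/
noncomputable def a (b : ℕ → T) (i : ℕ) : ℕ[X] :=
  ∏ j ∈ Finset.Icc 1 i, (b j : ℕ[X])

/-- The arguments `a_{i+1}, b_{i+2}, …, b_k`, which are `k - i` in number. -/
noncomputable def args (b : ℕ → T) (k i : ℕ) (j : Fin (k - i)) : ℕ[X] :=
  if (j : ℕ) = 0 then a b (i + 1) else (b (i + 1 + j) : ℕ[X])

/-- `(a_1 ⋯ a_i) x + P(a_{i+1}, b_{i+2}, …, b_k)`, as a polynomial in `t`. -/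
noncomputable def pointVal (b : ℕ → T) (x : T) (k i : ℕ) (P : MvPolynomial (Fin (k - i)) ℕ) :
    ℕ[X] :=
  (∏ j ∈ Finset.Icc 1 i, a b j) * (x : ℕ[X]) + MvPolynomial.aeval (args b k i) P

theorem a_ne_zero (b : ℕ → T) (i : ℕ) : a b i ≠ 0 :=
  Finset.prod_ne_zero_iff.2 fun j _ => (b j).2.1

theorem coeff_args (b : ℕ → T) (k i : ℕ) (j : Fin (k - i)) : (args b k i j).coeff 0 = 0 := by
  unfold args
  split_ifs
  · rw [a, Polynomial.coeff_zero_eq_eval_zero, Polynomial.eval_prod]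
    refine Finset.prod_eq_zero (i := 1) (by simp) ?_
    rw [← Polynomial.coeff_zero_eq_eval_zero]
    exact (b 1).2.2
  · exact (b _).2.2

theorem coeff_aeval {σ : Type*} (v : σ → ℕ[X]) (hv : ∀ j, (v j).coeff 0 = 0)
    (P : MvPolynomial σ ℕ) (hP : IsGood P) : (MvPolynomial.aeval v P).coeff 0 = 0 := by
  have h : (Polynomial.constantCoeff.comp (MvPolynomial.aeval v).toRingHom) =
      (MvPolynomial.constantCoeff : MvPolynomial σ ℕ →+* ℕ) := by
    refine MvPolynomial.ringHom_ext (fun n => by simp) (fun j => by simp [hv j])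
  have h2 := RingHom.congr_fun h P
  rw [show MvPolynomial.constantCoeff P = 0 from hP] at h2
  exact h2

theorem pointVal_mem (b : ℕ → T) (x : T) (k i : ℕ) (P : MvPolynomial (Fin (k - i)) ℕ)
    (hP : IsGood P) : pointVal b x k i P ≠ 0 ∧ (pointVal b x k i P).coeff 0 = 0 := by
  constructor
  · intro h
    have h1 : (∏ j ∈ Finset.Icc 1 i, a b j) * (x : ℕ[X]) = 0 := by
      ext n
      have := congrArg (fun q => Polynomial.coeff q n) h
      simp only [pointVal, Polynomial.coeff_add, Polynomial.coeff_zero] at this ⊢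
      omega
    exact mul_ne_zero (Finset.prod_ne_zero_iff.2 fun j _ => a_ne_zero b j) x.2.1 h1
  · simp [pointVal, Polynomial.mul_coeff_zero, x.2.2, coeff_aeval _ (coeff_args b k i) P hP]

theorem base_mem (b : ℕ → T) (x : T) (i : ℕ) :
    (∏ j ∈ Finset.Icc 1 i, a b j) * (x : ℕ[X]) ≠ 0 ∧
      ((∏ j ∈ Finset.Icc 1 i, a b j) * (x : ℕ[X])).coeff 0 = 0 :=
  ⟨mul_ne_zero (Finset.prod_ne_zero_iff.2 fun j _ => a_ne_zero b j) x.2.1,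
    by simp [Polynomial.mul_coeff_zero, x.2.2]⟩

/-- The element `(a_1 ⋯ a_i) x` of `T`. -/
noncomputable def base (b : ℕ → T) (x : T) (i : ℕ) : T :=
  ⟨(∏ j ∈ Finset.Icc 1 i, a b j) * (x : ℕ[X]), base_mem b x i⟩

/-- The element `(a_1 ⋯ a_i) x + P(a_{i+1}, b_{i+2}, …, b_k)` of `T`. -/
noncomputable def point (b : ℕ → T) (x : T) (k i : ℕ) (P : MvPolynomial (Fin (k - i)) ℕ)
    (hP : IsGood P) : T :=
  ⟨pointVal b x k i P, pointVal_mem b x k i P hP⟩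

end GoodPoly

/-!
The bounds `c i` only serve to make finite the set of polynomials `P` considered for each `i`, and
enlarging them makes the conclusion stronger. It is therefore enough to prove the colour statement
for arbitrary finite sets of good polynomials (`exists_forall_color_eq`); `F r c = c + 1` is then
an admissible choice.

Work in `ℤ[t]`, with the ideal `I = (t)` acting by translations and with `T` embedded as a cone in
`I`. Every finite subset of `I` can be translated into the cone, so there is a proper filter `f` on
`ℤ[t]` that contains the cone and is minimal among the filters invariant under `I`
(`exists_minimal_isInvariant_mem`). Call a set large if it meets all members of `f`. Largeness is
partition regular and translation invariant, and by minimality some finite union of translates of a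
large set belongs to `f` (`eventually_exists_add_mem`). So `f` plays the part of a minimal dynamical
system, and the large sets that of its nonempty open sets.

The main tool is polynomial recurrence (`recurrent`): for a large set `A` and finitely many one
variable polynomials `Q` over `ℤ[t]` without constant term there is `z` in the cone such that the
set of `x ∈ A` with `x + Q(z) ∈ A` for all `Q` is large. The proof is PET induction
(`weight_shiftSub_lt`), whose step is a colour focusing argument (`Recurrent.of_shiftSub`).

The `b_n` are then chosen one at a time (`exists_stage`). Let `m_n = a_1 ⋯ a_n`. After `n` steps
there is a large set of `w` for which, for each `i ≤ n`, the elements `m_i w` and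
`m_i w + P(a_{i+1}, b_{i+2}, …, b_n, 0, …, 0)` all have one colour `γ_i`. Put `b_{n+1} = z m_n`.
Each new value of `P` differs from the old one by `m_n` times a polynomial in `z` without constant
term (`exists_aeval_add_mul`), and `m_i` divides `m_n`, so the new point is
`m_i (w + Q(z)) + P(a_{i+1}, b_{i+2}, …, b_n, 0, …, 0)` for such a polynomial `Q`. Recurrence
applied to the finitely many `Q` keeps the colours `γ_i`, and partition regularity fixes the colour
`γ_{n+1}` of `m_{n+1} w`.
-/

namespace GoodPoly
open Filter

/-! ### Minimal translation-invariant filters -/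

section Filters

variable {G : Type*} [AddCommGroup G]

/-- A proper filter mapped into itself by all translations by elements of `V`. -/
def IsInvariant (V : AddSubgroup G) (f : Filter G) : Prop :=
  f.NeBot ∧ ∀ v ∈ V, Tendsto (· + v) f f

/-- Every invariant filter can be refined to a minimal one. The ultrafilters refining such a
filter form a minimal closed invariant subset of the Stone–Čech compactification. -/
theorem exists_minimal_isInvariant {V : AddSubgroup G} {f₀ : Filter G}
    (h₀ : IsInvariant V f₀) : ∃ f ≤ f₀, Minimal (IsInvariant V) f := by
  have inv_sInf : ∀ s : Set (Filter G), (∀ p ∈ s, IsInvariant V p) → DirectedOn (· ≥ ·) s →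
      s.Nonempty → IsInvariant V (sInf s) := by
    intro s hs hdir hne
    refine ⟨sInf_neBot_of_directed' hne hdir fun h => (hs _ h).1.ne rfl, fun v hv => ?_⟩
    exact le_sInf fun p hp => ((hs p hp).2 v hv).mono_left (sInf_le hp)
  refine zorn_le_nonempty₀ (α := (Filter G)ᵒᵈ) {f | IsInvariant V (OrderDual.ofDual f)} ?_ f₀ h₀
  intro c hc hchain y hy
  refine ⟨OrderDual.toDual (sInf (OrderDual.toDual ⁻¹' c)),
    inv_sInf _ (fun p hp => hc hp) (fun p hp q hq => ?_) ⟨OrderDual.ofDual y, hy⟩,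
    fun z hz => OrderDual.le_toDual.2 (sInf_le hz)⟩
  rcases hchain.total hp hq with h | h
  · exact ⟨q, hq, h, le_refl q⟩
  · exact ⟨p, hp, le_refl p, h⟩

/-- Finitely many translates of a set that meets a minimal invariant filter belong to it
together: return times are syndetic in a minimal system. -/
theorem eventually_exists_add_mem {V : AddSubgroup G} {f : Filter G}
    (hf : Minimal (IsInvariant V) f) {A : Set G} (hA : ∃ᶠ x in f, x ∈ A) :
    ∃ D : Finset V, ∀ᶠ x in f, ∃ d ∈ D, x + (d : G) ∈ A := by
  classical
  by_contra! hD
  let g : Filter G := ⨅ D : Finset V, f ⊓ 𝓟 {x | ∀ d ∈ D, x + (d : G) ∉ A}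
  have hle : ∀ D : Finset V, g ≤ f ⊓ 𝓟 {x | ∀ d ∈ D, x + (d : G) ∉ A} := iInf_le _
  have hev : ∀ D : Finset V, ∀ᶠ x in g, ∀ d ∈ D, x + (d : G) ∉ A := fun D =>
    ((hle D).trans inf_le_right) (mem_principal_self _)
  have hgf : g ≤ f := (hle ∅).trans inf_le_left
  have hg : IsInvariant V g := by
    constructor
    · refine iInf_neBot_of_directed' ?_ fun D => ?_
      · refine directed_of_isDirected_le fun D E hDE => inf_le_inf_left _ ?_
        exact principal_mono.2 fun x hx d hd => hx d (hDE hd)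
      · rw [inf_principal_neBot_iff]
        intro U hU
        obtain ⟨x, hx, hxU⟩ := ((hD D).and_eventually hU).exists
        exact ⟨x, hxU, hx⟩
    · intro v hv
      refine tendsto_iInf.2 fun D => tendsto_inf.2 ⟨(hf.prop.2 v hv).mono_left hgf, ?_⟩
      refine tendsto_principal.2 ?_
      filter_upwards [hev (D.image ((⟨v, hv⟩ : V) + ·))] with x hx d hd
      have := hx _ (Finset.mem_image_of_mem _ hd)
      simpa [add_assoc] using this
  have : ∀ᶠ x in f, x ∉ A := by
    refine (hf.le_of_le hg hgf) ?_
    filter_upwards [hev {0}] with x hx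
    simpa using hx
  exact hA this

theorem IsInvariant.frequently_add {V : AddSubgroup G} {f : Filter G} (hf : IsInvariant V f)
    {v : G} (hv : v ∈ V) {p : G → Prop} (h : ∃ᶠ x in f, p x) : ∃ᶠ x in f, p (x + v) := by
  have h1 := (hf.2 (-v) (V.neg_mem hv)).frequently (p := fun x => p (x + v))
  exact h1 (h.mono fun x hx => by simpa using hx)

/-- If every finite subset of `V` can be translated into `S`, then some minimal invariant filter
contains `S`. -/
theorem exists_minimal_isInvariant_mem (V : AddSubgroup G) (S : Set G)
    (hS : ∀ E : Finset V, ∃ z, ∀ e ∈ E, z + (e : G) ∈ S) :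
    ∃ f : Filter G, Minimal (IsInvariant V) f ∧ S ∈ f := by
  classical
  let f₀ : Filter G := ⨅ E : Finset V, 𝓟 {x | ∀ d ∈ E, x + (d : G) ∈ S}
  have hle : ∀ E : Finset V, ∀ᶠ x in f₀, ∀ d ∈ E, x + (d : G) ∈ S := fun E =>
    (iInf_le (fun E : Finset V => 𝓟 {x | ∀ d ∈ E, x + (d : G) ∈ S}) E) (mem_principal_self _)
  have h₀ : IsInvariant V f₀ := by
    constructor
    · refine iInf_neBot_of_directed' ?_ fun E => ?_
      · refine directed_of_isDirected_le fun D E hDE => ?_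
        exact principal_mono.2 fun x hx d hd => hx d (hDE hd)
      · exact principal_neBot_iff.2 (hS E)
    · intro v hv
      refine tendsto_iInf.2 fun D => tendsto_principal.2 ?_
      filter_upwards [hle (D.image (⟨v, hv⟩ + ·))] with x hx d hd
      have := hx _ (Finset.mem_image_of_mem _ hd)
      simpa [add_assoc] using this
  obtain ⟨f, hf, hmin⟩ := exists_minimal_isInvariant h₀
  refine ⟨f, hmin, hf ?_⟩
  filter_upwards [hle {0}] with x hx
  simpa using hx

end Filters

/-! ### Polynomial recurrence -/

section Recurrence

variable {R : Type*} [CommRing R]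

theorem eval_mem_of_coeff_zero {I : Ideal R} {P : R[X]} (hP : P.coeff 0 = 0) {b : R}
    (hb : b ∈ I) : P.eval b ∈ I := by
  obtain ⟨Q, rfl⟩ := Polynomial.X_dvd_iff.2 hP
  simpa using I.mul_mem_right _ hb

/-- The family `𝓕` is recurrent along `f`: for every set `A` that meets `f` there is `b ∈ S` such
that `A ∩ ⋂ P ∈ 𝓕, (A - P(b))` meets `f`. -/
def Recurrent (S : Set R) (f : Filter R) (𝓕 : Finset R[X]) : Prop :=
  ∀ A : Set R, (∃ᶠ x in f, x ∈ A) → ∃ b ∈ S, ∃ᶠ x in f, x ∈ A ∧ ∀ P ∈ 𝓕, x + P.eval b ∈ A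

/-- The polynomial `P(y + h) - P(h) - P₁(y)`. -/
noncomputable def shiftSub (P₁ P : R[X]) (h : R) : R[X] :=
  Polynomial.taylor h P - Polynomial.C (P.eval h) - P₁

theorem coeff_zero_shiftSub {P₁ P : R[X]} (h₁ : P₁.coeff 0 = 0) (h : R) :
    (shiftSub P₁ P h).coeff 0 = 0 := by
  simp [shiftSub, h₁, Polynomial.taylor_coeff_zero]

theorem eval_shiftSub (P₁ P : R[X]) (h b : R) :
    (shiftSub P₁ P h).eval b = P.eval (b + h) - P.eval h - P₁.eval b := by
  simp [shiftSub, Polynomial.taylor_eval]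

open scoped Classical in
/-- Colour focusing. The elements `d` of a finite set `D` serve as colours, `x` having the colour
`d` if `x + d ∈ A`. Each application of the hypothesis makes the points `x + P(h d)` take one more
colour `d`, for all `P ∈ 𝓕` at once, until `x` itself has one of the colours already used. -/
theorem Recurrent.of_shiftSub {I : Ideal R} {S : Set R} {f : Filter R}
    (hf : Minimal (IsInvariant I.toAddSubgroup) f) (hSI : S ⊆ I)
    (hadd : ∀ x ∈ S, ∀ y ∈ S, x + y ∈ S) {𝓕 : Finset R[X]} (h𝓕 : ∀ P ∈ 𝓕, P.coeff 0 = 0)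
    {P₁ : R[X]} (h₁ : P₁ ∈ 𝓕)
    (ih : ∀ H : Finset R, Recurrent S f ((𝓕 ×ˢ H).image fun q => shiftSub P₁ q.1 q.2)) :
    Recurrent S f 𝓕 := by
  classical
  intro A hA
  obtain ⟨D, hD⟩ := eventually_exists_add_mem hf hA
  by_contra hcon
  have key : ∀ n : ℕ, ∃ Q ⊆ D, Q.card = n ∧ ∃ h : I.toAddSubgroup → R, (∀ d ∈ Q, h d ∈ S) ∧
      ∃ᶠ x in f, ∀ d ∈ Q, ∀ P ∈ 𝓕, x + P.eval (h d) + d ∈ A := by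
    intro n
    induction n with
    | zero =>
      have := hf.prop.1
      exact ⟨∅, by simp, rfl, fun _ => 0, by simp, by simpa using this⟩
    | succ n hn =>
      obtain ⟨Q, hQD, rfl, h, hhS, hfr⟩ := hn
      have h3 : ∃ᶠ x in f, ∃ d ∈ D, (∀ e ∈ Q, ∀ P ∈ 𝓕, x + P.eval (h e) + e ∈ A) ∧
          x + d ∈ A := by
        refine (hfr.and_eventually hD).mono ?_
        rintro x ⟨hx, d, hd, hxd⟩
        exact ⟨d, hd, hx, hxd⟩
      obtain ⟨d, hd, h4⟩ := (frequently_exists_finset D).1 h3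
      have hdQ : d ∉ Q := by
        intro hdQ
        refine hcon ⟨h d, hhS d hdQ, ?_⟩
        refine (hf.prop.frequently_add (I.toAddSubgroup.neg_mem d.2) h4).mono ?_
        rintro x ⟨hx, hxd⟩
        refine ⟨by simpa using hxd, fun P hP => ?_⟩
        convert hx d hdQ P hP using 1
        ring
      let h' : I.toAddSubgroup → R := fun e => if e = d then 0 else h e
      -- `x` gets the colour `d`, with `h' d = 0`; the hypothesis then shifts all `h'` by `b`.
      have h5 : ∃ᶠ x in f, x ∈ {x | ∀ e ∈ insert d Q, ∀ P ∈ 𝓕, x + P.eval (h' e) + e ∈ A} := by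
        refine h4.mono ?_
        rintro x ⟨hx, hxd⟩ e he P hP
        by_cases hed : e = d
        · subst hed
          simpa [h', ← Polynomial.coeff_zero_eq_eval_zero, h𝓕 P hP] using hxd
        · simpa [h', hed] using hx e (Finset.mem_of_mem_insert_of_ne he hed) P hP
      obtain ⟨b, hb, h6⟩ := ih ((insert d Q).image h') _ h5
      refine ⟨insert d Q, Finset.insert_subset hd hQD, Finset.card_insert_of_notMem hdQ,
        fun e => b + h' e, fun e he => ?_, ?_⟩
      · by_cases hed : e = d
        · simpa [h', hed] using hb
        · simpa [h', hed] using hadd _ hb _ (hhS e (Finset.mem_of_mem_insert_of_ne he hed))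
      · refine (hf.prop.frequently_add
          (eval_mem_of_coeff_zero (h𝓕 P₁ h₁) (hSI hb)) h6).mono ?_
        rintro x ⟨-, hx⟩ e he P hP
        have hmem : shiftSub P₁ P (h' e) ∈
            (𝓕 ×ˢ (insert d Q).image h').image fun q => shiftSub P₁ q.1 q.2 :=
          Finset.mem_image.2 ⟨(P, h' e),
            Finset.mem_product.2 ⟨hP, Finset.mem_image_of_mem h' he⟩, rfl⟩
        have := hx _ hmem e he P hP
        rw [eval_shiftSub] at this
        convert this using 1
        ring
  obtain ⟨Q, hQD, hcard, -⟩ := key (D.card + 1)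
  have := Finset.card_le_card hQD
  omega

open scoped Classical in
/-- The classes of the nonzero members of `𝓕`, a class being a degree together with a leading
coefficient. -/
noncomputable def classes (𝓕 : Finset R[X]) : Finset (ℕ × R) :=
  (𝓕.filter (· ≠ 0)).image fun P => (P.natDegree, P.leadingCoeff)

/-- The multiset of the degrees of the classes of `𝓕`. -/
noncomputable def weight (𝓕 : Finset R[X]) : Multiset ℕ :=
  (classes 𝓕).val.map Prod.fst

theorem mem_classes {𝓕 : Finset R[X]} {P : R[X]} (hP : P ∈ 𝓕) (h0 : P ≠ 0) :
    (P.natDegree, P.leadingCoeff) ∈ classes 𝓕 := by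
  classical
  exact Finset.mem_image_of_mem (fun P : R[X] => (P.natDegree, P.leadingCoeff))
    (Finset.mem_filter.2 ⟨hP, h0⟩)

/-- The class of `shiftSub P₁ P h` when its degree is at least that of `P₁`. -/
theorem class_shiftSub {P₁ P : R[X]} (hpos : 0 < P₁.natDegree)
    (hle : P₁.natDegree ≤ P.natDegree) (h : R) (h0 : shiftSub P₁ P h ≠ 0)
    (hd : P₁.natDegree ≤ (shiftSub P₁ P h).natDegree) :
    (P₁.natDegree < (shiftSub P₁ P h).natDegree ∧ (shiftSub P₁ P h).natDegree = P.natDegree ∧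
      (shiftSub P₁ P h).leadingCoeff = P.leadingCoeff) ∨
    ((shiftSub P₁ P h).natDegree = P₁.natDegree ∧ P.natDegree = P₁.natDegree ∧
      (shiftSub P₁ P h).leadingCoeff + P₁.leadingCoeff = P.leadingCoeff) := by
  have hcoeff : ∀ n, 0 < n → (shiftSub P₁ P h).coeff n =
      (Polynomial.taylor h P).coeff n - P₁.coeff n := by
    intro n hn
    simp [shiftSub, Polynomial.coeff_C, hn.ne']
  have htop : (shiftSub P₁ P h).natDegree ≤ P.natDegree := by
    refine Polynomial.natDegree_le_iff_coeff_eq_zero.2 fun n hn => ?_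
    rw [hcoeff n (by omega), Polynomial.coeff_eq_zero_of_natDegree_lt (by simpa using hn),
      Polynomial.coeff_eq_zero_of_natDegree_lt (by omega), sub_zero]
  have hlc : (shiftSub P₁ P h).coeff P.natDegree = P.leadingCoeff - P₁.coeff P.natDegree := by
    rw [hcoeff _ (by omega), Polynomial.coeff_taylor_natDegree]
  rcases hle.lt_or_eq with hlt | heq
  · rw [Polynomial.coeff_eq_zero_of_natDegree_lt hlt, sub_zero] at hlc
    have hP : P.leadingCoeff ≠ 0 := by
      rw [Polynomial.leadingCoeff_ne_zero]
      rintro rfl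
      simp at hlt
    have hdeg : (shiftSub P₁ P h).natDegree = P.natDegree :=
      le_antisymm htop (Polynomial.le_natDegree_of_ne_zero (hlc ▸ hP))
    exact Or.inl ⟨hdeg ▸ hlt, hdeg, by rw [← hlc, ← hdeg, Polynomial.leadingCoeff]⟩
  · have hdeg : (shiftSub P₁ P h).natDegree = P₁.natDegree := by omega
    refine Or.inr ⟨hdeg, heq.symm, ?_⟩
    rw [← heq, ← hdeg] at hlc
    rw [Polynomial.leadingCoeff, hlc, hdeg]
    exact sub_add_cancel _ _

open scoped Classical in
/-- If `P₁` has the least degree among the nonzero members of `𝓕`, passing from `P` to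
`P(y + h) - P(h) - P₁(y)` keeps the classes of larger degree, removes the class of `P₁`, translates
the other classes of its degree, and otherwise adds only classes of smaller degree. -/
theorem weight_shiftSub_lt {𝓕 : Finset R[X]} {P₁ : R[X]}
    (h₁ : P₁ ∈ 𝓕) (hne : ∀ P ∈ 𝓕, P ≠ 0) (hpos : 0 < P₁.natDegree)
    (hmin : ∀ P ∈ 𝓕, P₁.natDegree ≤ P.natDegree) (H : Finset R) :
    Multiset.IsDershowitzMannaLT
      (weight ((𝓕 ×ˢ H).image fun q => shiftSub P₁ q.1 q.2)) (weight 𝓕) := by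
  classical
  set 𝓖 := (𝓕 ×ˢ H).image fun q => shiftSub P₁ q.1 q.2
  set d := P₁.natDegree
  set K := (classes 𝓖).filter fun q => d ≤ q.1
  let φ : ℕ × R → ℕ × R := fun q => if q.1 = d then (q.1, q.2 + P₁.leadingCoeff) else q
  have hφ1 : ∀ q, (φ q).1 = q.1 := by
    intro q
    dsimp only [φ]
    split_ifs <;> rfl
  have hφinj : Function.Injective φ := by
    intro p q hpq
    have h1 : p.1 = q.1 := by rw [← hφ1 p, hpq, hφ1]
    by_cases hd : q.1 = d
    · simp only [φ, h1, hd, if_true, Prod.mk.injEq, add_left_inj, true_and] at hpq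
      exact Prod.ext h1 hpq
    · simpa [φ, h1, hd] using hpq
  have hφK : K.image φ ⊆ (classes 𝓕).erase (d, P₁.leadingCoeff) := by
    intro q hq
    obtain ⟨q, hqK, rfl⟩ := Finset.mem_image.1 hq
    obtain ⟨hq𝓖, hdq⟩ := Finset.mem_filter.1 hqK
    obtain ⟨G, hG, rfl⟩ := Finset.mem_image.1 hq𝓖
    obtain ⟨hG, hG0⟩ := Finset.mem_filter.1 hG
    obtain ⟨⟨P, h⟩, hPh, rfl⟩ := Finset.mem_image.1 hG
    have hP := (Finset.mem_product.1 hPh).1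
    have hPc := mem_classes hP (hne P hP)
    rcases class_shiftSub hpos (hmin P hP) h hG0 hdq with ⟨h1, h2, h3⟩ | ⟨h1, h2, h3⟩
    · have hφ : φ ((shiftSub P₁ P h).natDegree, (shiftSub P₁ P h).leadingCoeff) =
          (P.natDegree, P.leadingCoeff) := by
        dsimp only [φ]
        rw [if_neg h1.ne', h2, h3]
      rw [hφ]
      refine Finset.mem_erase.2 ⟨fun h => ?_, hPc⟩
      have : P.natDegree = P₁.natDegree := congrArg Prod.fst h
      omega
    · have hφ : φ ((shiftSub P₁ P h).natDegree, (shiftSub P₁ P h).leadingCoeff) =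
          (P.natDegree, P.leadingCoeff) := by
        dsimp only [φ]
        rw [if_pos h1, h1, h2, h3]
      rw [hφ]
      refine Finset.mem_erase.2 ⟨fun h => ?_, hPc⟩
      have : P.leadingCoeff = P₁.leadingCoeff := congrArg Prod.snd h
      rw [this, add_eq_right, Polynomial.leadingCoeff_eq_zero] at h3
      exact hG0 h3
  have hXlt : K.val.map Prod.fst < weight 𝓕 := by
    have e1 : K.val.map Prod.fst = (K.image φ).val.map Prod.fst := by
      rw [Finset.image_val_of_injOn hφinj.injOn, Multiset.map_map]
      exact Multiset.map_congr rfl fun q _ => (hφ1 q).symm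
    rw [e1]
    refine (Multiset.map_le_map (Finset.val_le_iff.2 hφK)).trans_lt ?_
    exact Multiset.map_lt_map (Finset.val_lt_iff.2
      (Finset.erase_ssubset (mem_classes h₁ (hne P₁ h₁))))
  refine ⟨K.val.map Prod.fst, ((classes 𝓖).filter fun q => ¬ d ≤ q.1).val.map Prod.fst,
    weight 𝓕 - K.val.map Prod.fst, ?_, ?_, ?_, ?_⟩
  · intro h
    exact hXlt.not_ge (tsub_eq_zero_iff_le.1 h)
  · rw [← Multiset.map_add]
    simp only [K, Finset.filter_val, Multiset.filter_add_not]
    rfl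
  · exact (add_tsub_cancel_of_le hXlt.le).symm
  · intro y hy
    obtain ⟨z, hz⟩ := Multiset.exists_mem_of_ne_zero
      (fun h => hXlt.not_ge (tsub_eq_zero_iff_le.1 h) : weight 𝓕 - K.val.map Prod.fst ≠ 0)
    refine ⟨z, hz, ?_⟩
    obtain ⟨q, hq, rfl⟩ := Multiset.mem_map.1 hy
    obtain ⟨p, hp, rfl⟩ := Multiset.mem_map.1 (Multiset.mem_of_le tsub_le_self hz)
    obtain ⟨P, hP, rfl⟩ := Finset.mem_image.1 (show p ∈ classes 𝓕 from hp)
    have h1 := hmin P (Finset.mem_filter.1 hP).1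
    have h2 := (Finset.mem_filter.1 (show q ∈ (classes 𝓖).filter fun q => ¬ d ≤ q.1 from hq)).2
    exact lt_of_lt_of_le (not_le.1 h2) h1

/-- Polynomial recurrence: along a minimal invariant filter, every finite family of polynomials
without constant term is recurrent. -/
theorem recurrent {I : Ideal R} {S : Set R} {f : Filter R}
    (hf : Minimal (IsInvariant I.toAddSubgroup) f) (hSI : S ⊆ I) (hS : S.Nonempty)
    (hadd : ∀ x ∈ S, ∀ y ∈ S, x + y ∈ S) (𝓕 : Finset R[X]) (h𝓕 : ∀ P ∈ 𝓕, P.coeff 0 = 0) :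
    Recurrent S f 𝓕 := by
  classical
  refine (InvImage.wf weight Multiset.wellFounded_isDershowitzMannaLT).induction
    (C := fun 𝓕 : Finset R[X] => (∀ P ∈ 𝓕, P.coeff 0 = 0) → Recurrent S f 𝓕) 𝓕 ?_ h𝓕
  clear! 𝓕
  intro 𝓕 ih h𝓕
  let 𝓔 := 𝓕.filter (· ≠ 0)
  have hw𝓔 : weight 𝓔 = weight 𝓕 := by simp [weight, classes, 𝓔]
  have h𝓔 : ∀ P ∈ 𝓔, P ∈ 𝓕 ∧ P ≠ 0 := fun P hP => Finset.mem_filter.1 hP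
  suffices h : Recurrent S f 𝓔 by
    intro A hA
    obtain ⟨b, hb, hx⟩ := h A hA
    refine ⟨b, hb, hx.mono fun x hx => ⟨hx.1, fun P hP => ?_⟩⟩
    by_cases hP0 : P = 0
    · simpa [hP0] using hx.1
    · exact hx.2 P (Finset.mem_filter.2 ⟨hP, hP0⟩)
  rcases 𝓔.eq_empty_or_nonempty with he | hne
  · intro A hA
    obtain ⟨b, hb⟩ := hS
    exact ⟨b, hb, hA.mono fun x hx => ⟨hx, by simp [he]⟩⟩
  · obtain ⟨P₁, h₁, hmin⟩ := 𝓔.exists_min_image Polynomial.natDegree hne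
    have hpos : 0 < P₁.natDegree := by
      rw [Nat.pos_iff_ne_zero]
      intro h0
      refine (h𝓔 P₁ h₁).2 ?_
      rw [Polynomial.eq_C_of_natDegree_eq_zero h0, h𝓕 P₁ (h𝓔 P₁ h₁).1, Polynomial.C_0]
    refine Recurrent.of_shiftSub hf hSI hadd (fun P hP => h𝓕 P (h𝓔 P hP).1) h₁ fun H => ?_
    have hlt := weight_shiftSub_lt h₁ (fun P hP => (h𝓔 P hP).2) hpos hmin H
    rw [hw𝓔] at hlt
    refine ih _ hlt ?_
    intro G hG
    obtain ⟨q, -, rfl⟩ := Finset.mem_image.1 hG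
    exact coeff_zero_shiftSub (h𝓕 P₁ (h𝓔 P₁ h₁).1) _

end Recurrence

/-! ### Choice of the sequence `b` -/

section Sequence

variable {R : Type*} [CommRing R]

/-- The product `b 1 * ⋯ * b i`. -/
def cumProd (b : ℕ → R) (i : ℕ) : R :=
  ∏ j ∈ Finset.Icc 1 i, b j

/-- The product `a 1 * ⋯ * a i`, where `a j = b 1 * ⋯ * b j`. -/
def mult (b : ℕ → R) (i : ℕ) : R :=
  ∏ j ∈ Finset.Icc 1 i, cumProd b j

/-- The arguments `a_{i+1}, b_{i+2}, …, b_k`, with `b_{n+1}, b_{n+2}, …` replaced by `0`. -/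
def truncArgs (b : ℕ → R) (k i n : ℕ) (j : Fin (k - i)) : R :=
  if i + 1 + j ≤ n then if (j : ℕ) = 0 then cumProd b (i + 1) else b (i + 1 + j) else 0

theorem cumProd_congr {b b' : ℕ → R} {i : ℕ} (h : ∀ j ≤ i, b j = b' j) :
    cumProd b i = cumProd b' i :=
  Finset.prod_congr rfl fun j hj => h j (Finset.mem_Icc.1 hj).2

theorem cumProd_succ (b : ℕ → R) (i : ℕ) : cumProd b (i + 1) = cumProd b i * b (i + 1) :=
  Finset.prod_Icc_succ_top (by omega) _

theorem mult_congr {b b' : ℕ → R} {i : ℕ} (h : ∀ j ≤ i, b j = b' j) : mult b i = mult b' i :=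
  Finset.prod_congr rfl fun _ hj =>
    cumProd_congr fun l hl => h l (hl.trans (Finset.mem_Icc.1 hj).2)

theorem mult_dvd_mult (b : ℕ → R) {i n : ℕ} (h : i ≤ n) : mult b i ∣ mult b n :=
  Finset.prod_dvd_prod_of_subset _ _ _ (Finset.Icc_subset_Icc_right h)

theorem mul_mult_mem {S : Set R} (hmul : ∀ x ∈ S, ∀ y ∈ S, x * y ∈ S) {b : ℕ → R}
    (hb : ∀ j, b j ∈ S) (n : ℕ) {z : R} (hz : z ∈ S) : z * mult b n ∈ S := by
  have key : ∀ (s : Finset ℕ) (g : ℕ → R), (∀ j ∈ s, ∀ z ∈ S, z * g j ∈ S) →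
      ∀ z ∈ S, z * ∏ j ∈ s, g j ∈ S := fun s g hg =>
    Finset.prod_induction g (fun x => ∀ z ∈ S, z * x ∈ S)
      (fun x y hx hy z hz => mul_assoc z x y ▸ hy _ (hx z hz)) (by simp) hg
  exact key _ _ (fun _ _ => key _ _ fun l _ z hz => hmul z hz _ (hb l)) z hz

theorem truncArgs_self (b : ℕ → R) (k n : ℕ) : truncArgs b k n n = 0 := by
  funext j
  simp only [truncArgs, Pi.zero_apply]
  rw [if_neg (by omega)]

theorem aeval_zero_of_isGood {σ : Type*} {P : MvPolynomial σ ℕ} (hP : IsGood P) :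
    MvPolynomial.aeval (0 : σ → R) P = 0 := by
  rw [MvPolynomial.aeval_zero, show MvPolynomial.constantCoeff P = 0 from hP, map_zero]

/-- The effect on the truncated arguments of the choice `b_{n+1} = z a_1 ⋯ a_n`. -/
theorem truncArgs_update (b : ℕ → R) (k : ℕ) {i n : ℕ} (hi : i ≤ n) (z : R) :
    truncArgs (Function.update b (n + 1) (z * mult b n)) k i (n + 1) = fun j =>
      truncArgs b k i n j + mult b n * z *
        if i + j = n then if (j : ℕ) = 0 then cumProd b n else 1 else 0 := by
  have hold : ∀ j ≤ n, Function.update b (n + 1) (z * mult b n) j = b j := fun j hj =>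
    Function.update_of_ne (by omega) _ _
  funext j
  by_cases h : i + 1 + j ≤ n
  · rw [truncArgs, truncArgs, if_pos h, if_pos (h.trans n.le_succ),
      if_neg (show ¬ i + (j : ℕ) = n by omega), mul_zero, add_zero, hold _ h]
    split_ifs with hj
    · exact cumProd_congr (b' := b) fun l hl => hold l (by omega)
    · rfl
  · rw [truncArgs, truncArgs, if_neg h, zero_add]
    by_cases h' : i + j = n
    · rw [if_pos h', if_pos (by omega)]
      split_ifs with hj
      · obtain rfl : i = n := by omega
        rw [cumProd_succ, cumProd_congr hold, Function.update_self]
        ring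
      · rw [show i + 1 + (j : ℕ) = n + 1 by omega, Function.update_self]
        ring
    · rw [if_neg h', if_neg (by omega), mul_zero]

/-- A polynomial evaluated at `v + m z u` differs from its value at `v` by `m` times a polynomial
in `z` without constant term. -/
theorem exists_aeval_add_mul {σ : Type*} (P : MvPolynomial σ ℕ) (v u : σ → R) (m : R) :
    ∃ Q : R[X], Q.coeff 0 = 0 ∧ ∀ z : R, MvPolynomial.aeval (fun j => v j + m * z * u j) P =
      MvPolynomial.aeval v P + m * Q.eval z := by
  induction P using MvPolynomial.induction_on with
  | C c => exact ⟨0, by simp, by simp⟩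
  | add P₁ P₂ h₁ h₂ =>
    obtain ⟨Q₁, h₁, h₁'⟩ := h₁
    obtain ⟨Q₂, h₂, h₂'⟩ := h₂
    refine ⟨Q₁ + Q₂, by simp [h₁, h₂], fun z => ?_⟩
    rw [map_add, map_add, h₁', h₂', Polynomial.eval_add]
    ring
  | mul_X P j h =>
    obtain ⟨Q, h, h'⟩ := h
    refine ⟨Q * Polynomial.C (v j) +
      (Polynomial.C (MvPolynomial.aeval v P) + Polynomial.C m * Q) * Polynomial.C (u j) *
        Polynomial.X, by simp [h, Polynomial.mul_coeff_zero], fun z => ?_⟩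
    simp only [map_mul, h', MvPolynomial.aeval_X, Polynomial.eval_add, Polynomial.eval_mul,
      Polynomial.eval_C, Polynomial.eval_X]
    ring

/-- The inductive construction of `b`. After `n` steps the points whose colours are controlled are
those obtained by setting `b_j = 0` for `j > n`. -/
theorem exists_stage {I : Ideal R} {S : Set R} {f : Filter R}
    (hf : Minimal (IsInvariant I.toAddSubgroup) f) (hSI : S ⊆ I) (hS : S.Nonempty)
    (hadd : ∀ x ∈ S, ∀ y ∈ S, x + y ∈ S) (hmul : ∀ x ∈ S, ∀ y ∈ S, x * y ∈ S)
    {κ : Type*} [Finite κ] (χ : R → κ) (k : ℕ)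
    (𝓠 : ∀ i, Finset (MvPolynomial (Fin (k - i)) ℕ)) (h𝓠 : ∀ i, ∀ P ∈ 𝓠 i, IsGood P) (n : ℕ) :
    ∃ b : ℕ → R, (∀ j, b j ∈ S) ∧ ∃ γ : ℕ → κ, ∃ᶠ w in f, ∀ i ≤ n,
      χ (mult b i * w) = γ i ∧
        ∀ P ∈ 𝓠 i, χ (mult b i * w + MvPolynomial.aeval (truncArgs b k i n) P) = γ i := by
  classical
  have := hf.prop.1
  have htop : ∀ (b : ℕ → R) (n : ℕ) (w : R), ∀ P ∈ 𝓠 n,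
      mult b n * w + MvPolynomial.aeval (truncArgs b k n n) P = mult b n * w := by
    intro b n w P hP
    rw [truncArgs_self, aeval_zero_of_isGood (h𝓠 n P hP), add_zero]
  induction n with
  | zero =>
    obtain ⟨s, hs⟩ := hS
    have h : ∃ᶠ w in f, ∃ c, χ (mult (fun _ => s) 0 * w) = c :=
      Eventually.frequently (Eventually.of_forall fun w => ⟨_, rfl⟩)
    obtain ⟨c, hc⟩ := frequently_exists.1 h
    refine ⟨fun _ => s, fun _ => hs, fun _ => c, hc.mono fun w hw i hi => ?_⟩
    obtain rfl : i = 0 := by omega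
    exact ⟨hw, fun P hP => by rw [htop _ _ _ P hP, hw]⟩
  | succ n ih =>
    obtain ⟨b, hbS, γ, hfr⟩ := ih
    set A : Set R := {w | ∀ i ≤ n, χ (mult b i * w) = γ i ∧
        ∀ P ∈ 𝓠 i, χ (mult b i * w + MvPolynomial.aeval (truncArgs b k i n) P) = γ i} with hA
    choose Q hQ0 hQ using fun (i : ℕ) (P : MvPolynomial (Fin (k - i)) ℕ) =>
      exists_aeval_add_mul P (truncArgs b k i n)
        (fun j => if i + (j : ℕ) = n then if (j : ℕ) = 0 then cumProd b n else 1 else 0) (mult b n)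
    have hdvd : ∀ i, ∃ m, i ≤ n → mult b n = mult b i * m := by
      intro i
      by_cases hi : i ≤ n
      · obtain ⟨m, hm⟩ := mult_dvd_mult b hi
        exact ⟨m, fun _ => hm⟩
      · exact ⟨0, fun h => absurd h hi⟩
    choose m hm using hdvd
    obtain ⟨z, hz, hfr'⟩ := recurrent hf hSI hS hadd
      ((Finset.range (n + 1)).biUnion fun i => (𝓠 i).image fun P => Polynomial.C (m i) * Q i P)
      (by
        intro G hG
        obtain ⟨i, -, hG⟩ := Finset.mem_biUnion.1 hG
        obtain ⟨P, -, rfl⟩ := Finset.mem_image.1 hG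
        simp [hQ0]) A hfr
    set b' := Function.update b (n + 1) (z * mult b n) with hb'
    have hmult : ∀ i ≤ n, mult b' i = mult b i := fun i hi =>
      mult_congr fun j hj => Function.update_of_ne (by omega) _ _
    have hcol : ∃ᶠ w in f, ∃ c, χ (mult b' (n + 1) * w) = c ∧ w ∈ A ∧
        ∀ i ≤ n, ∀ P ∈ 𝓠 i, w + m i * (Q i P).eval z ∈ A := by
      refine hfr'.mono fun w hw => ⟨_, rfl, hw.1, fun i hi P hP => ?_⟩
      have := hw.2 (Polynomial.C (m i) * Q i P) (Finset.mem_biUnion.2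
        ⟨i, Finset.mem_range.2 (by omega), Finset.mem_image_of_mem _ hP⟩)
      simpa using this
    obtain ⟨c, hc⟩ := frequently_exists.1 hcol
    refine ⟨b', fun j => ?_, Function.update γ (n + 1) c, hc.mono ?_⟩
    · by_cases hj : j = n + 1
      · rw [hj, hb', Function.update_self]
        exact mul_mult_mem hmul hbS n hz
      · rw [hb', Function.update_of_ne hj]
        exact hbS j
    · rintro w ⟨hwc, hwA, hw⟩ i hi
      rcases Nat.le_succ_iff.1 hi with hi | rfl
      · rw [Function.update_of_ne (by omega), hmult i hi]
        refine ⟨(hwA i hi).1, fun P hP => ?_⟩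
        have e : mult b i * w + MvPolynomial.aeval (truncArgs b' k i (n + 1)) P =
            mult b i * (w + m i * (Q i P).eval z) +
              MvPolynomial.aeval (truncArgs b k i n) P := by
          rw [hb', truncArgs_update b k hi z, hQ, hm i hi]
          ring
        rw [e]
        exact ((hw i hi P hP) i hi).2 P hP
      · rw [Nat.succ_eq_add_one, Function.update_self]
        exact ⟨hwc, fun P hP => by rw [htop _ _ _ P hP, hwc]⟩

end Sequence

/-! ### Polynomials in `t` -/

theorem finite_setOf_size_le (n c : ℕ) :
    {P : MvPolynomial (Fin n) ℕ | size P ≤ c}.Finite := by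
  let B : Set (Fin n →₀ ℕ) := Set.Iic (Finsupp.equivFunOnFinite.symm fun _ => c)
  have hB : Finite B := Set.finite_Iic _
  have hcoeff : ∀ P : MvPolynomial (Fin n) ℕ, size P ≤ c → ∀ m, P.coeff m < c + 1 := by
    intro P hP m
    by_cases hm : m ∈ P.support
    · exact Nat.lt_succ_of_le
        ((Finset.le_sup (f := fun m => P.coeff m) hm).trans ((le_max_right _ _).trans hP))
    · rw [MvPolynomial.notMem_support_iff.1 hm]
      omega
  have hzero : ∀ P : MvPolynomial (Fin n) ℕ, size P ≤ c → ∀ m ∉ B, P.coeff m = 0 := by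
    intro P hP m hm
    by_contra h
    refine hm fun j => ?_
    exact (MvPolynomial.le_degreeOf_of_mem_support j (MvPolynomial.mem_support_iff.2 h)).trans
      ((MvPolynomial.degreeOf_le_totalDegree P j).trans ((le_max_left _ _).trans hP))
  let g : {P : MvPolynomial (Fin n) ℕ | size P ≤ c} → B → Fin (c + 1) := fun P m =>
    ⟨P.1.coeff m, hcoeff P.1 P.2 m⟩
  refine Finite.of_injective g fun P P' h => Subtype.ext (MvPolynomial.ext _ _ fun m => ?_)
  by_cases hm : m ∈ B
  · exact congrArg Fin.val (congrFun h ⟨m, hm⟩)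
  · rw [hzero _ P.2 m hm, hzero _ P'.2 m hm]

/-- The inclusion of `ℕ[t]` in `ℤ[t]`. -/
noncomputable def toInt : ℕ[X] →+* ℤ[X] :=
  Polynomial.mapRingHom (Nat.castRingHom ℤ)

theorem toInt_injective : Function.Injective toInt :=
  Polynomial.map_injective _ Nat.cast_injective

/-- The image of `T` in `ℤ[t]`. -/
def cone : Set ℤ[X] :=
  Set.range fun p : T => toInt p

theorem cone_subset : cone ⊆ (Ideal.span {Polynomial.X} : Ideal ℤ[X]) := by
  rintro _ ⟨p, rfl⟩
  refine Ideal.mem_span_singleton.2 (Polynomial.X_dvd_iff.2 ?_)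
  simp [toInt, p.2.2]

theorem cone_nonempty : cone.Nonempty :=
  ⟨_, ⟨⟨Polynomial.X, Polynomial.X_ne_zero, by simp⟩, rfl⟩⟩

theorem add_mem_cone : ∀ x ∈ cone, ∀ y ∈ cone, x + y ∈ cone := by
  rintro _ ⟨p, rfl⟩ _ ⟨q, rfl⟩
  refine ⟨⟨p + q, fun h => p.2.1 ?_, by simp [p.2.2, q.2.2]⟩, by simp⟩
  ext n
  have := congrArg (fun f => Polynomial.coeff f n) h
  simp only [Polynomial.coeff_add, Polynomial.coeff_zero] at this ⊢
  omega

theorem mul_mem_cone : ∀ x ∈ cone, ∀ y ∈ cone, x * y ∈ cone := by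
  rintro _ ⟨p, rfl⟩ _ ⟨q, rfl⟩
  exact ⟨⟨p * q, mul_ne_zero p.2.1 q.2.1, by simp [Polynomial.mul_coeff_zero, p.2.2]⟩, by simp⟩

theorem mem_cone {g : ℤ[X]} (h0 : g ≠ 0) (hc : g.coeff 0 = 0) (hn : ∀ n, 0 ≤ g.coeff n) :
    g ∈ cone := by
  have : ∃ p : ℕ[X], toInt p = g :=
    (Polynomial.mem_lifts g).1 ((Polynomial.lifts_iff_coeff_lifts g).2 fun n =>
      ⟨(g.coeff n).toNat, by simp [hn n]⟩)
  obtain ⟨p, rfl⟩ := this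
  refine ⟨⟨p, fun h => h0 (by simp [h]), ?_⟩, rfl⟩
  simpa [toInt] using hc

/-- Every integer polynomial without constant term is a difference of two elements of the cone. -/
theorem exists_mem_cone_add_mem_cone {e : ℤ[X]} (he : e.coeff 0 = 0) :
    ∃ s ∈ cone, s + e ∈ cone := by
  obtain ⟨N, hN⟩ : ∃ N : ℤ[X], ∀ n, N.coeff n = |e.coeff n| := by
    refine ⟨∑ i ∈ e.support, Polynomial.monomial i |e.coeff i|, fun n => ?_⟩
    by_cases h : e.coeff n = 0 <;> simp [Polynomial.coeff_monomial, h]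
  have hX : ∀ n, 0 ≤ (Polynomial.X : ℤ[X]).coeff n := by
    intro n
    rw [Polynomial.coeff_X]
    split_ifs <;> simp
  -- The summand `t` makes both polynomials nonzero, as their coefficients at `t` are positive.
  refine ⟨Polynomial.X + N, mem_cone (fun h => ?_) (by simp [hN, he]) fun n => ?_,
    mem_cone (fun h => ?_) (by simp [hN, he]) fun n => ?_⟩
  · have := congrArg (fun p => Polynomial.coeff p 1) h
    simp only [Polynomial.coeff_add, Polynomial.coeff_X_one, hN, Polynomial.coeff_zero] at this
    have := abs_nonneg (e.coeff 1)
    omega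
  · rw [Polynomial.coeff_add, hN]
    exact add_nonneg (hX n) (abs_nonneg _)
  · have := congrArg (fun p => Polynomial.coeff p 1) h
    simp only [Polynomial.coeff_add, Polynomial.coeff_X_one, hN, Polynomial.coeff_zero] at this
    have := neg_abs_le (e.coeff 1)
    omega
  · rw [Polynomial.coeff_add, Polynomial.coeff_add, hN]
    have := neg_abs_le (e.coeff n)
    have := hX n
    omega

theorem exists_add_mem_cone
    (E : Finset (Ideal.span {Polynomial.X} : Ideal ℤ[X]).toAddSubgroup) :
    ∃ z, ∀ e ∈ E, z + (e : ℤ[X]) ∈ cone := by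
  classical
  suffices h : ∃ z ∈ cone, ∀ e ∈ E, z + (e : ℤ[X]) ∈ cone from ⟨h.choose, h.choose_spec.2⟩
  induction E using Finset.induction_on with
  | empty =>
    obtain ⟨z, hz⟩ := cone_nonempty
    exact ⟨z, hz, by simp⟩
  | insert e E _ ih =>
    obtain ⟨z, hz, hE⟩ := ih
    obtain ⟨s, hs, hse⟩ := exists_mem_cone_add_mem_cone (e := e)
      (Polynomial.X_dvd_iff.1 (Ideal.mem_span_singleton.1 e.2))
    refine ⟨z + s, add_mem_cone _ hz _ hs, fun d hd => ?_⟩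
    rcases Finset.mem_insert.1 hd with rfl | hd
    · rw [add_assoc]
      exact add_mem_cone _ hz _ hse
    · rw [add_right_comm]
      exact add_mem_cone _ (hE d hd) _ hs

theorem toInt_a {b : ℕ → ℤ[X]} {B : ℕ → T} (hB : ∀ j, toInt (B j) = b j) (i : ℕ) :
    toInt (a B i) = cumProd b i := by
  rw [a, cumProd, map_prod]
  exact Finset.prod_congr rfl fun j _ => hB j

theorem toInt_base {b : ℕ → ℤ[X]} {B : ℕ → T} (hB : ∀ j, toInt (B j) = b j) (x : T) (i : ℕ) :
    toInt (base B x i) = mult b i * toInt x := by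
  rw [base, map_mul, mult, map_prod]
  congr 1
  exact Finset.prod_congr rfl fun j _ => toInt_a hB j

theorem toInt_pointVal {b : ℕ → ℤ[X]} {B : ℕ → T} (hB : ∀ j, toInt (B j) = b j) (x : T) {k i : ℕ}
    (P : MvPolynomial (Fin (k - i)) ℕ) :
    toInt (pointVal B x k i P) =
      mult b i * toInt x + MvPolynomial.aeval (truncArgs b k i k) P := by
  have hargs : (fun j => toInt (args B k i j)) = truncArgs b k i k := by
    funext j
    have hj := j.2
    rw [args, truncArgs, if_pos (show i + 1 + (j : ℕ) ≤ k by omega)]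
    split_ifs
    · exact toInt_a hB _
    · exact hB _
  rw [pointVal, map_add, ← hargs]
  congr 1
  · exact toInt_base hB x i
  · exact MvPolynomial.comp_aeval_apply _ (RingHom.toNatAlgHom toInt) P

/-- The colour statement for any finite sets of good polynomials, in place of those of bounded
size. -/
theorem exists_forall_color_eq {κ : Type*} [Finite κ] (C : T → κ) (k : ℕ)
    (𝓠 : ∀ i, Finset (MvPolynomial (Fin (k - i)) ℕ)) (h𝓠 : ∀ i, ∀ P ∈ 𝓠 i, IsGood P) :
    ∃ (b : ℕ → T) (x : T), ∀ i ≤ k, ∀ (P : MvPolynomial (Fin (k - i)) ℕ) (hP : IsGood P),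
      P ∈ 𝓠 i → C (point b x k i P hP) = C (base b x i) := by
  obtain ⟨f, hf, hcone⟩ := exists_minimal_isInvariant_mem _ cone exists_add_mem_cone
  let t : T := ⟨Polynomial.X, Polynomial.X_ne_zero, by simp⟩
  -- Outside the cone the colour is irrelevant, since `f` contains the cone.
  let χ : ℤ[X] → κ := Function.extend (fun p : T => toInt p) C fun _ => C t
  have hχ : ∀ p : T, χ (toInt p) = C p := fun p =>
    (toInt_injective.comp Subtype.val_injective).extend_apply C (fun _ => C t) p
  obtain ⟨b, hb, γ, hfr⟩ := exists_stage hf cone_subset cone_nonempty add_mem_cone mul_mem_cone χ k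
    𝓠 h𝓠 k
  choose B hB using hb
  obtain ⟨_, hw, x, rfl⟩ := (hfr.and_eventually hcone).exists
  refine ⟨B, x, fun i hi P hP hPQ => ?_⟩
  rw [← hχ, ← hχ, toInt_base hB, point, toInt_pointVal hB]
  exact ((hw i hi).2 P hPQ).trans (hw i hi).1.symm

end GoodPoly

theorem mainTheorem3 :
    ∃ F : ℕ → ℕ → ℕ, Primrec₂ F ∧
      ∀ (r : ℕ) (C : GoodPoly.T → Fin r) (k ck : ℕ), 0 < k → 0 < ck →
        ∃ (c : ℕ → ℕ) (b : ℕ → GoodPoly.T),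
          c k = ck ∧ (∀ i ≤ k, 0 < c i) ∧
          (∀ i < k, c i = F r (c (i + 1)) ∧ c (i + 1) < c i) ∧
          ∃ x : GoodPoly.T, ∀ i < k,
            ∀ (P : MvPolynomial (Fin (k - i)) ℕ) (hP : GoodPoly.IsGood P),
              GoodPoly.size P ≤ c i →
                C (GoodPoly.point b x k i P hP) = C (GoodPoly.base b x i) := by
  -- Only the finiteness of the set of polynomials of size at most `c i` matters, so any strictly
  -- decreasing sequence of bounds will do.
  refine ⟨fun _ c => c + 1, Primrec.succ.comp Primrec.snd, fun r C k ck _ hck => ?_⟩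
  have hfin : ∀ i, {P : MvPolynomial (Fin (k - i)) ℕ |
      GoodPoly.size P ≤ ck + (k - i) ∧ GoodPoly.IsGood P}.Finite := fun i =>
    (GoodPoly.finite_setOf_size_le _ _).subset fun P hP => hP.1
  obtain ⟨b, x, hx⟩ := GoodPoly.exists_forall_color_eq C k (fun i => (hfin i).toFinset)
    fun i P hP => ((hfin i).mem_toFinset.1 hP).2
  refine ⟨fun i => ck + (k - i), b, by simp, fun i _ => by positivity, fun i hi => ?_, x,
    fun i hi P hP hs => hx i hi.le P hP ((hfin i).mem_toFinset.2 ⟨hs, hP⟩)⟩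
  constructor <;> dsimp only <;> omega
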